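/- Let $n\ge 2$ and $e>0$ be integers, let $S=\mathbb{C}[x_0,\dots,x_n]$, and let $W:g=0$ be a smooth hypersurface of degree $e$ in $\mathbb{P}^n$, where $g\in S$ is homogeneous of degree $e$. Put $f=x_0x_1\cdots x_n\,g$ and assume that the hypersurface $V:f=0$ is a normal crossing divisor in $\mathbb{P}^n$, i.e. near each of its points $V$ is given by an equation $t_1\cdots t_r=0$, where $t_1,\dots,t_r$ are part of a system of local analytic coordinates centred at that point ($f$ being, in an affine chart, a unit times $t_1\cdots t_r$). Write $f_j,g_j$ for the partial derivatives with respect to $x_j$, set $g'_i=x_ig_i+g$ for $0\le i\le n$, and let $$D_0(f)=\Big\{(a_0,\dots,a_n)\in S^{n+1} : \sum_{j=0}^n a_jf_j=0\Big\}$$ be the graded $S$-module of Jacobian syzygies of $f$. For $0\le i<j\le n$ let $\rho'_{ij}\in S^{n+1}$ be the vector whose $i$-th component is $x_ig'_j$, whose $j$-th component is $-x_jg'_i$, and whose other components are zero. Then each $\rho'_{ij}$ is homogeneous of degree $e+1$ and has exactly two nonzero components (the $i$-th and the $j$-th), and the $\rho'_{ij}$, $0\le i<j\le n$, are $\binom{n+1}{2}$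 distinct elements which form a minimal set of generators of the $S$-module $D_0(f)$: they generate $D_0(f)$, no proper subset of them does, and $D_0(f)$ cannot be generated by fewer than $\binom{n+1}{2}$ elements. -/

import Mathlib

noncomputable section

namespace JacobianSyzygies

open MvPolynomial Topology

/-- The hypersurface `g = 0` in `ℙⁿ` (with `g` homogeneous in the `n + 1` variables) is smooth:
at every point of it some partial derivative of `g` does not vanish. -/
def IsSmoothHypersurface {n : ℕ} (g : MvPolynomial (Fin (n + 1)) ℂ) : Prop :=
  ∀ p : Fin (n + 1) → ℂ, p ≠ 0 → eval p g = 0 → ∃ i, eval p (pderiv i g) ≠ 0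

/-- The functions `t 0, …, t (n - 1)` form a system of local analytic coordinates of `ℂⁿ`
centred at `y`: they are analytic at `y`, vanish at `y`, and their differentials at `y`
are linearly independent. -/
def IsLocalCoordinates {n : ℕ} (t : Fin n → (Fin n → ℂ) → ℂ) (y : Fin n → ℂ) : Prop :=
  (∀ i, AnalyticAt ℂ (t i) y) ∧ (∀ i, t i y = 0) ∧
    LinearIndependent ℂ (fun i => fderiv ℂ (t i) y)

/-- The divisor `F = 0` has normal crossings at `y`: near `y`, the function `F` is a
nowhere vanishing analytic function times a product of distinct members of a system of
local analytic coordinates centred at `y`. -/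
def IsNormalCrossingAt {n : ℕ} (F : (Fin n → ℂ) → ℂ) (y : Fin n → ℂ) : Prop :=
  ∃ (t : Fin n → (Fin n → ℂ) → ℂ) (s : Finset (Fin n)) (u : (Fin n → ℂ) → ℂ),
    IsLocalCoordinates t y ∧ AnalyticAt ℂ u y ∧ u y ≠ 0 ∧
      ∀ᶠ z in 𝓝 y, F z = u z * ∏ i ∈ s, t i z

/-- The restriction of `f` to the standard affine chart `x_k = 1` of `ℙⁿ`, as a function
on `ℂⁿ`. -/
def affineChart {n : ℕ} (f : MvPolynomial (Fin (n + 1)) ℂ) (k : Fin (n + 1))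
    (y : Fin n → ℂ) : ℂ :=
  eval (k.insertNth 1 y : Fin (n + 1) → ℂ) f

/-- The hypersurface `f = 0` in `ℙⁿ` (with `f` homogeneous) is a normal crossing divisor:
it has normal crossings at each of its points, tested in the standard affine charts. -/
def IsNormalCrossingDivisor {n : ℕ} (f : MvPolynomial (Fin (n + 1)) ℂ) : Prop :=
  ∀ (k : Fin (n + 1)) (y : Fin n → ℂ), affineChart f k y = 0 →
    IsNormalCrossingAt (affineChart f k) y

/-- The module `D₀(f)` of Jacobian syzygies of `f`. -/
def D₀ {n : ℕ} (f : MvPolynomial (Fin (n + 1)) ℂ) :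
    Submodule (MvPolynomial (Fin (n + 1)) ℂ) (Fin (n + 1) → MvPolynomial (Fin (n + 1)) ℂ) where
  carrier := {a | ∑ j, a j * pderiv j f = 0}
  zero_mem' := by simp
  add_mem' := by
    intro a b ha hb
    simp only [Set.mem_ofPred_eq, Pi.add_apply, add_mul, Finset.sum_add_distrib] at *
    rw [ha, hb, add_zero]
  smul_mem' := by
    intro c a ha
    simp only [Set.mem_ofPred_eq, Pi.smul_apply, smul_eq_mul, mul_assoc, ← Finset.mul_sum] at *
    rw [ha, mul_zero]

/-- `g'_i = x_i g_i + g`, where `g_i` is the `i`-th partial derivative of `g`. -/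
def gPrime {n : ℕ} (g : MvPolynomial (Fin (n + 1)) ℂ) (i : Fin (n + 1)) :
    MvPolynomial (Fin (n + 1)) ℂ :=
  X i * pderiv i g + g

/-- `ρ'_{ij}`: the `i`-th component is `x_i g'_j`, the `j`-th component is `-x_j g'_i`, and
the other components are zero. -/
def rhoPrime {n : ℕ} (g : MvPolynomial (Fin (n + 1)) ℂ) (i j : Fin (n + 1)) :
    Fin (n + 1) → MvPolynomial (Fin (n + 1)) ℂ :=
  fun k => if k = i then X i * gPrime g j else if k = j then -(X j * gPrime g i) else 0

/-- `X` is a minimal set of generators of the submodule `N`: it generates `N` and no proper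
subset of it does. -/
def IsMinimalGenerators {R M : Type*} [Semiring R] [AddCommMonoid M] [Module R M]
    (X : Set M) (N : Submodule R M) : Prop :=
  Minimal (fun Y : Set M => Submodule.span R Y = N) X

end JacobianSyzygies

end

noncomputable section

namespace JacobianSyzygies

open MvPolynomial Topology

/-! By the product rule `∂f/∂x_j` is `g'_j` times the product of the `x_i` with `i ≠ j`. In a syzygy
`a` of these partials `x_j` divides every term but the `j`-th, and `g'_j ≡ g` modulo `x_j` is prime
to `x_j`; hence `a_j = x_j b_j`, and the condition becomes `∑ b_j g'_j = 0`. It remains to show that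
the `g'_j` have only Koszul syzygies (`span_rhoPrime_eq_D₀`).

For this the `g'_j` must vanish together only at the origin (`eq_zero_of_eval_gPrime_eq_zero`). By
Euler their sum is `(e + n + 1) g`, so at a common zero `g = 0` and every `x_i g_i = 0`. Then `dg`
is a combination of the `dx_i` with `x_i = 0` there, against normal crossings and smoothness.

Now there are `n + 1` polynomials in `n + 1` variables with no common zero off the origin. As
`Ext^i(S/m, S) = 0` for `i < n + 1`, generic linear combinations of them form a regular sequence, so
all relations are Koszul, and this survives a change of basis (`hasKoszulSyzygies_of_eval_eq_zero`).

Minimality is graded Nakayama: the `ρ'_{ij}` share one degree and are independent over `ℂ`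
(`card_le_card_of_span_eq`). -/

/-- The first Koszul homology of the family `c` on `M` vanishes: every relation
`∑ j, c j • b j = 0` comes from an alternating matrix. -/
def HasKoszulSyzygies {R : Type*} (M : Type*) [CommRing R] [AddCommGroup M] [Module R M]
    {r : ℕ} (c : Fin r → R) : Prop :=
  ∀ b : Fin r → M, ∑ j, c j • b j = 0 →
    ∃ A : Fin r → Fin r → M, (∀ i, A i i = 0) ∧ (∀ i j, A i j = -A j i) ∧
      ∀ i, b i = ∑ j, c j • A i j

/-! ### Koszul syzygies: adjoining a regular element, change of basis -/

section Koszul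

variable {R M : Type*} [CommRing R] [AddCommGroup M] [Module R M]

lemma sum_sum_smul_alternating_eq_zero {r : ℕ} (c : Fin r → R) (A : Fin r → Fin r → M)
    (h0 : ∀ i, A i i = 0) (hA : ∀ i j, A i j = -A j i) :
    ∑ i, c i • ∑ j, c j • A i j = 0 := by
  simp only [Finset.smul_sum, ← Finset.sum_product']
  refine Finset.sum_involution (fun p _ => (p.2, p.1)) ?_ ?_ ?_ ?_
  · rintro ⟨i, j⟩ -
    simp only [hA j i, smul_neg, smul_smul, mul_comm (c j)]
    exact add_neg_cancel _
  · rintro ⟨i, j⟩ - h he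
    simp only [Prod.mk.injEq] at he
    exact h (by simp [he.1, h0])
  · simp
  · simp

/-- An arbitrary entrywise lift need not be alternating, so only the entries above the diagonal are
lifted and the rest follow by skew-symmetry. -/
lemma exists_alternating_lift {N : Submodule R M} {r : ℕ} (A : Fin r → Fin r → M ⧸ N)
    (h0 : ∀ i, A i i = 0) (hA : ∀ i j, A i j = -A j i) :
    ∃ B : Fin r → Fin r → M, (∀ i, B i i = 0) ∧ (∀ i j, B i j = -B j i) ∧
      ∀ i j, Submodule.Quotient.mk (p := N) (B i j) = A i j := by
  choose L hL using fun i j => Submodule.Quotient.mk_surjective N (A i j)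
  refine ⟨fun i j => if i < j then L i j else if j < i then -L j i else 0, ?_, ?_, ?_⟩
  · simp
  · intro i j
    rcases lt_trichotomy i j with h | rfl | h
    · simp [h, h.not_gt]
    · simp
    · simp [h, h.not_gt]
  · intro i j
    rcases lt_trichotomy i j with h | rfl | h
    · simp [h, hL]
    · simp [h0]
    · simp [h, h.not_gt, hL, hA i j]

-- Reduce the relation modulo `c`, lift the resulting alternating matrix to `B`, and write the
-- errors as `c • a i`. On substituting back the alternating part cancels, and regularity of `c`
-- gives `b 0 = -∑ d i • a i`; bordering `B` with `a` and `-a` then gives the required matrix.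
open Pointwise in
lemma HasKoszulSyzygies.cons {c : R} (hc : IsSMulRegular M c) {r : ℕ} {d : Fin r → R}
    (hd : HasKoszulSyzygies (QuotSMulTop c M) d) :
    HasKoszulSyzygies M (Fin.cons c d : Fin (r + 1) → R) := by
  intro b hb
  rw [Fin.sum_univ_succ] at hb
  simp only [Fin.cons_zero, Fin.cons_succ] at hb
  let q : M →ₗ[R] QuotSMulTop c M := Submodule.mkQ _
  have hq (m : M) (hm : q m = 0) : ∃ a, m = c • a := by
    have : m ∈ c • (⊤ : Submodule R M) := (Submodule.Quotient.mk_eq_zero _).1 hm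
    obtain ⟨a, -, ha⟩ := (Submodule.mem_smul_pointwise_iff_exists _ _ _).1 this
    exact ⟨a, ha.symm⟩
  have hqc (m : M) : q (c • m) = 0 :=
    (Submodule.Quotient.mk_eq_zero _).2 (Submodule.smul_mem_pointwise_smul _ _ _ trivial)
  have h1 : ∑ j, d j • q (b j.succ) = 0 := by
    have := congrArg q hb
    simpa [hqc, map_sum] using this
  obtain ⟨A, h0, hA, hbA⟩ := hd _ h1
  obtain ⟨B, hB0, hB, hBA⟩ := exists_alternating_lift A h0 hA
  have h2 (i : Fin r) : ∃ a, b i.succ - ∑ j, d j • B i j = c • a := by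
    apply hq
    rw [map_sub, hbA, map_sum, sub_eq_zero]
    refine Finset.sum_congr rfl fun j _ => ?_
    rw [map_smul, ← hBA]
    rfl
  choose a ha using h2
  have h3 (i : Fin r) : b i.succ = c • a i + ∑ j, d j • B i j := by
    rw [← ha]; abel
  have h4 : b 0 = -∑ i, d i • a i := by
    rw [← sub_eq_zero, sub_neg_eq_add]
    apply hc.right_eq_zero_of_smul
    rw [← hb, smul_add]
    congr 1
    simp only [h3, smul_add, Finset.sum_add_distrib]
    rw [sum_sum_smul_alternating_eq_zero d B hB0 hB, add_zero, Finset.smul_sum]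
    exact Finset.sum_congr rfl fun j _ => smul_comm _ _ _
  refine ⟨Fin.cons (Fin.cons 0 fun j => -a j) fun i => Fin.cons (a i) (B i), ?_, ?_, ?_⟩
  · intro i
    cases i using Fin.cases <;> simp [hB0]
  · intro i j
    cases i using Fin.cases <;> cases j using Fin.cases <;> simp
    exact hB _ _
  · intro i
    cases i using Fin.cases <;> simp [Fin.sum_univ_succ, h3, h4]

/-- With `c = Q h` and `h = P c`, a relation `b` on `h` becomes the relation `Pᵀ b` on `c`, and its
alternating matrix `A` is carried back to `Qᵀ A Q`. -/
lemma HasKoszulSyzygies.of_matrix_mul_eq_one {r : ℕ} {c h : Fin r → R}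
    (hc : HasKoszulSyzygies M c) (P Q : Matrix (Fin r) (Fin r) R) (hPQ : P * Q = 1)
    (hch : ∀ i, c i = ∑ j, Q i j * h j) : HasKoszulSyzygies M h := by
  have hQP : ∀ i j, ∑ k, P i k * Q k j = if i = j then 1 else 0 := fun i j => by
    rw [← Matrix.mul_apply, hPQ, Matrix.one_apply]
  have hhc : ∀ j, h j = ∑ i, P j i * c i := fun j => by
    simp only [hch, Finset.mul_sum]
    rw [Finset.sum_comm]
    simp only [← mul_assoc, ← Finset.sum_mul, hQP]
    simp
  intro b hb
  obtain ⟨A, h0, hA, hbA⟩ := hc (fun i => ∑ j, P j i • b j) (by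
    rw [← hb]
    simp only [hhc, Finset.smul_sum, Finset.sum_smul, smul_smul]
    rw [Finset.sum_comm]
    simp only [mul_comm])
  refine ⟨fun j l => ∑ i, ∑ k, (Q i j * Q k l) • A i k, fun j => ?_, fun j l => ?_, fun j => ?_⟩
  · have := sum_sum_smul_alternating_eq_zero (fun i => Q i j) A h0 hA
    simpa only [Finset.smul_sum, smul_smul] using this
  · beta_reduce
    rw [Finset.sum_comm]
    simp only [← Finset.sum_neg_distrib]
    refine Finset.sum_congr rfl fun i _ => Finset.sum_congr rfl fun k _ => ?_
    rw [hA, smul_neg, mul_comm]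
  · have h1 : b j = ∑ i, Q i j • ∑ l, P l i • b l := by
      simp only [Finset.smul_sum, smul_smul]
      rw [Finset.sum_comm]
      simp only [← Finset.sum_smul, mul_comm (Q _ _), hQP]
      simp
    rw [h1]
    simp only [hbA, hch, Finset.smul_sum, Finset.sum_smul, smul_smul]
    conv_rhs => rw [Finset.sum_comm]
    refine Finset.sum_congr rfl fun i _ => ?_
    conv_rhs => rw [Finset.sum_comm]
    refine Finset.sum_congr rfl fun k _ => Finset.sum_congr rfl fun l _ => ?_
    congr 1
    ring

lemma HasKoszulSyzygies.of_basis {K V : Type*} [Field K] [Algebra K R] [AddCommGroup V]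
    [Module K V] (h : V →ₗ[K] R) {r : ℕ} (b b' : Module.Basis (Fin r) K V)
    (hb : HasKoszulSyzygies M (h ∘ b)) : HasKoszulSyzygies M (h ∘ b') := by
  refine hb.of_matrix_mul_eq_one ((b.toMatrix b').transpose.map (algebraMap K R))
    ((b'.toMatrix b).transpose.map (algebraMap K R)) ?_ fun i => ?_
  · rw [← Matrix.map_mul, ← Matrix.transpose_mul, b'.toMatrix_mul_toMatrix_flip]
    simp
  · conv_lhs => rw [Function.comp_apply, ← b'.sum_repr (b i), map_sum]
    simp [Module.Basis.toMatrix_apply, Algebra.smul_def]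

end Koszul

/-! ### Generic regular elements and vanishing of Ext -/

section Depth

open CategoryTheory Abelian

/-- Prime avoidance over an infinite field: each of the finitely many associated primes pulls back
to a proper subspace of `V`, and `V` is not a finite union of proper subspaces. Including `⊥` among
them makes `v` nonzero. -/
lemma exists_ne_zero_isSMulRegular {K R M V : Type*} [Field K] [Infinite K] [CommRing R]
    [IsNoetherianRing R] [Algebra K R] [AddCommGroup M] [Module R M] [Module.Finite R M]
    [AddCommGroup V] [Module K V] [Nontrivial V] (h : V →ₗ[K] R)
    (hp : ∀ p ∈ associatedPrimes R M, ∃ v, h v ∉ p) : ∃ v ≠ 0, IsSMulRegular M (h v) := by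
  classical
  have hfin := associatedPrimes.finite R M
  let U : Ideal R → Subspace K V := fun p => (p.restrictScalars K).comap h
  have htop : ⊤ ∉ insert (⊥ : Subspace K V) (hfin.toFinset.image U) := by
    simp only [Finset.mem_insert, Finset.mem_image, Set.Finite.mem_toFinset, not_or, not_exists,
      not_and]
    refine ⟨top_ne_bot, fun p hpM hU => ?_⟩
    obtain ⟨v, hv⟩ := hp p hpM
    have : v ∈ U p := hU ▸ trivial
    exact hv this
  obtain ⟨v, hv⟩ := (Set.ne_univ_iff_exists_notMem _).1
    (Subspace.biUnion_ne_univ_of_top_notMem htop)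
  simp only [Finset.mem_insert, Finset.mem_image, Set.Finite.mem_toFinset, Set.mem_iUnion,
    not_exists] at hv
  refine ⟨v, fun h0 => hv ⊥ (Or.inl rfl) (by simp [h0]), ?_⟩
  by_contra hreg
  have : h v ∈ ⋃ p ∈ associatedPrimes R M, (p : Set R) := by
    rw [biUnion_associatedPrimes_eq_compl_regular R M]
    exact hreg
  simp only [Set.mem_iUnion] at this
  obtain ⟨p, hpM, hvp⟩ := this
  exact hv (U p) (Or.inr ⟨p, hpM, rfl⟩) hvp

universe u

open Pointwise in
/-- If `Ext N M i` vanishes for `i < r` and the image of the `r`-dimensional space `V` cuts out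
the support of `N` in that of `M`, a generic basis of `V` has only Koszul syzygies on `M`. -/
theorem exists_basis_hasKoszulSyzygies {K : Type*} {R : Type u} [Field K] [Infinite K] [CommRing R]
    [IsNoetherianRing R] [Algebra K R] (N : ModuleCat.{u} R) [Module.Finite R N] (r : ℕ)
    {V : Type*} [AddCommGroup V] [Module K V] [FiniteDimensional K V]
    (hV : Module.finrank K V = r) (h : V →ₗ[K] R) (M : ModuleCat.{u} R) [Module.Finite R M]
    (hsupp : ∀ p : Ideal R, p.IsPrime → Module.annihilator R M ≤ p → (∀ v, h v ∈ p) →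
      Module.annihilator R N ≤ p)
    (hext : ∀ i < r, Subsingleton (Ext N M i)) :
    ∃ b : Module.Basis (Fin r) K V, HasKoszulSyzygies M (h ∘ b) := by
  induction r generalizing V M with
  | zero =>
    refine ⟨Module.finBasisOfFinrankEq K V hV, fun b _ => ⟨fun _ _ => 0, ?_, ?_, ?_⟩⟩ <;>
      exact fun i => i.elim0
  | succ r ih =>
    have : Nontrivial V := Module.nontrivial_of_finrank_pos (R := K) (by omega)
    have : Subsingleton (N ⟶ M) := Ext.addEquiv₀.subsingleton_congr.mp (hext 0 r.zero_lt_succ)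
    have : Subsingleton (N →ₗ[R] M) := ModuleCat.homAddEquiv.symm.subsingleton
    obtain ⟨x, hxN, hx⟩ := IsSMulRegular.subsingleton_linearMap_iff.mp this
    -- An associated prime of `M` containing `h(V)` would contain the annihilator of `N`, hence `x`,
    -- which is regular on `M`.
    obtain ⟨v, hv0, hv⟩ := exists_ne_zero_isSMulRegular (M := M) h fun p hp => by
      by_contra! hall
      have hxp : x ∈ p := hsupp p hp.isPrime
        (Submodule.annihilator_top (R := R) (M := M) ▸ hp.annihilator_le) hall hxN
      have : x ∈ ⋃ p ∈ associatedPrimes R M, (p : Set R) := Set.mem_biUnion hp hxp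
      rw [biUnion_associatedPrimes_eq_compl_regular R M] at this
      exact this hx
    obtain ⟨W, hW⟩ := Submodule.exists_isCompl (K ∙ v)
    have hWr : Module.finrank K W = r := by
      have := Submodule.finrank_add_eq_of_isCompl hW
      rw [finrank_span_singleton hv0] at this
      omega
    have hann : h v ∈ Module.annihilator R (QuotSMulTop (h v) M) := by
      rw [Module.mem_annihilator]
      intro m
      obtain ⟨m, rfl⟩ := Submodule.Quotient.mk_surjective _ m
      exact (Submodule.Quotient.mk_eq_zero _).2 (Submodule.smul_mem_pointwise_smul _ _ _ trivial)
    have hdec : ∀ z : V, ∃ c : K, z + c • v ∈ W := fun z => by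
      obtain ⟨y, hy, w, hw, rfl⟩ := Submodule.mem_sup.1
        (show z ∈ (K ∙ v) ⊔ W from hW.sup_eq_top ▸ trivial)
      obtain ⟨c, rfl⟩ := Submodule.mem_span_singleton.1 hy
      exact ⟨-c, by simpa [add_right_comm] using hw⟩
    have hsupp' : ∀ p : Ideal R, p.IsPrime →
        Module.annihilator R (ModuleCat.of R (QuotSMulTop (h v) M)) ≤ p →
        (∀ w, (h ∘ₗ W.subtype) w ∈ p) → Module.annihilator R N ≤ p := by
      intro p hp hMp hWp
      refine hsupp p hp ?_ ?_
      · refine le_trans (fun a ha => ?_) hMp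
        rw [Module.mem_annihilator] at ha ⊢
        intro m
        obtain ⟨m, rfl⟩ := Submodule.Quotient.mk_surjective _ m
        rw [← Submodule.Quotient.mk_smul, ha, Submodule.Quotient.mk_zero]
      · intro z
        obtain ⟨c, hc⟩ := hdec z
        have h1 := hWp ⟨_, hc⟩
        have h2 : h v ∈ p := hMp hann
        simp only [LinearMap.comp_apply, Submodule.subtype_apply, map_add, map_smul] at h1
        refine (p.add_mem_iff_left ?_).1 h1
        rw [Algebra.smul_def]
        exact p.mul_mem_left _ h2
    -- The long exact sequence for multiplication by `h v` costs one degree of vanishing.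
    have hext' : ∀ i < r, Subsingleton (Ext N (ModuleCat.of R (QuotSMulTop (h v) M)) i) := by
      intro i hi
      have zero1 := AddCommGrpCat.isZero_of_iff_subsingleton.mpr (hext i (by omega))
      have zero2 := AddCommGrpCat.isZero_of_iff_subsingleton.mpr (hext (i + 1) (by omega))
      exact AddCommGrpCat.subsingleton_of_isZero <| ShortComplex.Exact.isZero_of_both_zeros
        ((Ext.covariant_sequence_exact₃' N hv.smulShortComplex_shortExact) i (i + 1) rfl)
        (zero1.eq_zero_of_src _) (zero2.eq_zero_of_tgt _)
    obtain ⟨b, hb⟩ := ih hWr (h ∘ₗ W.subtype) (ModuleCat.of R (QuotSMulTop (h v) M)) hsupp' hext'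
    refine ⟨Module.Basis.mkFinCons v b ?_ hdec, ?_⟩
    · intro c x hx hcx
      have h1 : c • v ∈ W := by
        rw [eq_neg_of_add_eq_zero_left hcx]
        exact W.neg_mem hx
      have h2 : c • v = 0 := Submodule.disjoint_def.1 hW.disjoint _
        (Submodule.smul_mem _ _ (Submodule.mem_span_singleton_self v)) h1
      exact (smul_eq_zero.1 h2).resolve_right hv0
    · have := HasKoszulSyzygies.cons hv hb
      convert this using 1
      rw [Module.Basis.coe_mkFinCons]
      funext i
      cases i using Fin.cases <;> simp

end Depth

/-! ### Polynomials vanishing together only at the origin -/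

section PolynomialRing

variable {K : Type} [Field K] {n : ℕ}

/-- Membership in an ideal generated by variables is tested monomial by monomial, and a further
factor `X i` creates no divisibility by the earlier variables. -/
lemma isRegular_X : RingTheory.Sequence.IsRegular (MvPolynomial (Fin n) K)
    (List.ofFn fun i : Fin n => (X i : MvPolynomial (Fin n) K)) := by
  have htake (i : ℕ) : Ideal.ofList ((List.ofFn fun i : Fin n =>
      (X i : MvPolynomial (Fin n) K)).take i) = Ideal.span (X '' {j : Fin n | (j : ℕ) < i}) := by
    refine congrArg _ (Set.ext fun p => ?_)
    simp only [Set.mem_ofPred_eq, List.mem_take_iff_getElem, List.getElem_ofFn, Set.mem_image]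
    constructor
    · rintro ⟨j, hj, rfl⟩
      simp only [List.length_ofFn, lt_inf_iff] at hj
      exact ⟨⟨j, hj.2⟩, hj.1, rfl⟩
    · rintro ⟨j, hj, rfl⟩
      exact ⟨j, by simp [hj], rfl⟩
  refine ⟨⟨fun i hi => ?_⟩, ?_⟩
  · rw [htake, isSMulRegular_quotient_iff_mem_of_smul_mem]
    simp only [smul_eq_mul, Ideal.mul_top, List.getElem_ofFn]
    intro p hp
    rw [mem_ideal_span_X_image] at hp ⊢
    intro m hm
    have hi' : i < n := by simpa using hi
    obtain ⟨j, hj, hjm⟩ := hp (Finsupp.single ⟨i, hi'⟩ 1 + m) (by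
      rw [mem_support_iff, coeff_X_mul]
      exact mem_support_iff.1 hm)
    refine ⟨j, hj, ?_⟩
    have : (⟨i, hi'⟩ : Fin n) ≠ j := fun h => by
      have : (j : ℕ) < i := hj
      rw [← h] at this
      simp at this
    simpa [Finsupp.single_apply, this] using hjm
  · have := htake n
    rw [List.take_of_length_le (by simp)] at this
    rw [this, smul_eq_mul, Ideal.mul_top]
    intro h
    have h1 : (1 : MvPolynomial (Fin n) K) ∈ Ideal.span (X '' {j : Fin n | (j : ℕ) < n}) :=
      h ▸ trivial
    rw [mem_ideal_span_X_image] at h1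
    obtain ⟨j, -, hj⟩ := h1 0 (by simp)
    simp at hj

/-- Polynomials in as many variables as there are polynomials, whose only common zero is at most
the origin, have only Koszul syzygies. -/
theorem hasKoszulSyzygies_of_eval_eq_zero [IsAlgClosed K] (h : Fin n → MvPolynomial (Fin n) K)
    (hz : ∀ p : Fin n → K, (∀ i, eval p (h i) = 0) → p = 0) :
    HasKoszulSyzygies (MvPolynomial (Fin n) K) h := by
  have : Infinite K := IsAlgClosed.instInfinite
  let S := MvPolynomial (Fin n) K
  let m : Ideal S := Ideal.span (Set.range X)
  have hofm : Ideal.ofList (List.ofFn fun i : Fin n => (X i : S)) = m := by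
    refine congrArg _ (Set.ext fun p => ?_)
    simp [List.mem_ofFn, eq_comm]
  let N : ModuleCat.{0} S := ModuleCat.of S (S ⧸ m)
  have hNann : Module.annihilator S N = m := Ideal.annihilator_quotient
  have hreg := isRegular_X (K := K) (n := n)
  have hext := ModuleCat.subsingleton_ext_of_exists_isRegular m N
    (by rw [Module.support_eq_zeroLocus, hNann]) (ModuleCat.of S S) (by
      have := hreg.top_ne_smul
      rw [hofm] at this
      exact lt_top_iff_ne_top.2 this.symm) _ (fun r hr => by
      obtain ⟨i, rfl⟩ := List.mem_ofFn.1 hr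
      exact Ideal.subset_span ⟨i, rfl⟩) hreg
  rw [List.length_ofFn] at hext
  -- Taking `K^n` rather than the span of the `h i` avoids assuming them independent.
  let φ : (Fin n → K) →ₗ[K] S := Fintype.linearCombination K h
  have hφ (i : Fin n) : φ (Pi.basisFun K (Fin n) i) = h i := by
    simp [φ, Fintype.linearCombination_apply, Pi.single_apply]
  obtain ⟨b, hb⟩ := exists_basis_hasKoszulSyzygies (K := K) N n (by simp) φ (ModuleCat.of S S)
    (fun p hp _ hpφ => by
      rw [hNann, Ideal.span_le]
      rintro _ ⟨i, rfl⟩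
      -- Nullstellensatz: a prime containing all `h i` has zero locus inside `{0}`, so it contains
      -- every variable.
      have := MvPolynomial.IsPrime.vanishingIdeal_zeroLocus (K := K) p
      rw [← this, SetLike.mem_coe, mem_vanishingIdeal_iff]
      intro x hx
      have : x = 0 := hz x fun i => by
        have h1 : h i ∈ p := hφ i ▸ hpφ _
        simpa [aeval_eq_eval] using mem_zeroLocus_iff.1 hx _ h1
      simp [this]) hext
  have := hb.of_basis φ b (Pi.basisFun K (Fin n))
  convert this using 1
  exact (funext hφ).symm

end PolynomialRing

/-! ### Leading forms and independence of differentials -/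

section LeadingForm

open Filter

variable {E : Type*} [NormedAddCommGroup E] [NormedSpace ℂ E]

/-- Along a line through `y` each factor is linear to first order, so the leading coefficient is the
product of the differentials. -/
lemma tendsto_mul_prod_div_pow {α : Type*} (s : Finset α) {t : α → E → ℂ} {τ : α → E →L[ℂ] ℂ}
    {u : E → ℂ} {y : E} (hu : ContinuousAt u y) (ht : ∀ i ∈ s, HasFDerivAt (t i) (τ i) y)
    (ht0 : ∀ i ∈ s, t i y = 0) (v : E) :
    Tendsto (fun ε : ℂ => (u (y + ε • v) * ∏ i ∈ s, t i (y + ε • v)) / ε ^ s.card) (𝓝[≠] 0)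
      (𝓝 (u y * ∏ i ∈ s, τ i v)) := by
  have hline : Tendsto (fun ε : ℂ => y + ε • v) (𝓝[≠] 0) (𝓝 y) := by
    have : Continuous fun ε : ℂ => y + ε • v := by fun_prop
    have := this.tendsto 0
    simp only [zero_smul, add_zero] at this
    exact this.mono_left nhdsWithin_le_nhds
  have h1 : Tendsto (fun ε : ℂ => ∏ i ∈ s, ε⁻¹ • (t i (y + ε • v) - t i y)) (𝓝[≠] 0)
      (𝓝 (∏ i ∈ s, τ i v)) :=
    tendsto_finsetProd s fun i hi =>
      hasLineDerivAt_iff_tendsto_slope_zero.1 ((ht i hi).hasLineDerivAt v)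
  refine ((hu.tendsto.comp hline).mul h1).congr fun ε => ?_
  rw [Function.comp_apply, mul_div_assoc]
  congr 1
  rw [div_eq_inv_mul, ← inv_pow, ← Finset.prod_const, ← Finset.prod_mul_distrib]
  exact Finset.prod_congr rfl fun i hi => by rw [ht0 i hi, sub_zero, smul_eq_mul]

lemma le_of_tendsto_div_pow {F : ℂ → ℂ} {a b : ℕ} {A B : ℂ} (hB : B ≠ 0)
    (ha : Tendsto (fun ε => F ε / ε ^ a) (𝓝[≠] 0) (𝓝 A))
    (hb : Tendsto (fun ε => F ε / ε ^ b) (𝓝[≠] 0) (𝓝 B)) : a ≤ b := by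
  by_contra! hlt
  have hpow : Tendsto (fun ε : ℂ => ε ^ (a - b)) (𝓝[≠] 0) (𝓝 0) := by
    have := ((continuous_pow (M := ℂ) (a - b)).tendsto 0)
    rw [zero_pow (by omega)] at this
    exact this.mono_left nhdsWithin_le_nhds
  have h0 := ha.mul hpow
  rw [mul_zero] at h0
  refine hB (tendsto_nhds_unique (hb.congr' ?_) h0)
  filter_upwards [self_mem_nhdsWithin] with ε hε
  have hε : ε ≠ 0 := hε
  rw [div_mul_eq_mul_div, div_eq_div_iff (pow_ne_zero _ hε) (pow_ne_zero _ hε), mul_assoc,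
    ← pow_add]
  congr 2
  omega

/-- If two products of nonzero linear forms with the same number of factors agree up to nonzero
constants, and the factors of one are linearly independent, so are the factors of the other. -/
lemma linearIndependent_of_prod_eq {V α β : Type*} [AddCommGroup V] [Module ℂ V] [Fintype α]
    [Fintype β] (hcard : Fintype.card α = Fintype.card β) {l : α → Module.Dual ℂ V}
    {τ : β → Module.Dual ℂ V} (hτ : LinearIndependent ℂ τ) (hl : ∀ a, l a ≠ 0) {A B : ℂ}
    (hA : A ≠ 0) (h : ∀ v, A * ∏ a, l a v = B * ∏ b, τ b v) : LinearIndependent ℂ l := by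
  -- On `ker (τ b)` the product of the `l a` is zero. Finitely many nonzero forms have a common
  -- point of nonvanishing, so some `l a` is zero on this kernel, hence a multiple of `τ b`.
  have key (b : β) : ∃ a, ∃ c : ℂ, l a = c • τ b := by
    have : ∃ a, ∀ v : LinearMap.ker (τ b), l a v = 0 := by
      by_contra! hne
      obtain ⟨v, hv⟩ := Module.Dual.exists_forall_ne_zero_of_forall_exists
        (fun a => l a ∘ₗ (LinearMap.ker (τ b)).subtype) hne
      have h1 := h v
      have h2 : ∏ b, τ b (v : V) = 0 := Finset.prod_eq_zero (Finset.mem_univ b) v.2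
      rw [h2, mul_zero] at h1
      exact mul_ne_zero hA (Finset.prod_ne_zero_iff.2 fun a _ => hv a) h1
    obtain ⟨a, ha⟩ := this
    have hb : τ b ≠ 0 := hτ.ne_zero b
    obtain ⟨w, hw⟩ : ∃ w, τ b w ≠ 0 := by
      by_contra! h0
      exact hb (LinearMap.ext h0)
    refine ⟨a, l a w / τ b w, LinearMap.ext fun v => ?_⟩
    have h1 := ha ⟨v - (τ b v / τ b w) • w, by simp [hw]⟩
    simp only [map_sub, map_smul, smul_eq_mul] at h1
    rw [LinearMap.smul_apply, smul_eq_mul, sub_eq_zero.1 h1]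
    ring
  choose σ c hc using key
  have hc0 (b : β) : c b ≠ 0 := fun h0 => hl (σ b) (by rw [hc, h0, zero_smul])
  have hli : LinearIndependent ℂ (l ∘ σ) := by
    have := hτ.units_smul fun b => Units.mk0 (c b) (hc0 b)
    convert this using 1
    exact funext hc
  have hσ : Function.Injective σ := hli.injective.of_comp
  have hbij := (Fintype.bijective_iff_injective_and_card σ).2 ⟨hσ, hcard.symm⟩
  exact (linearIndependent_equiv (Equiv.ofBijective σ hbij)).1 hli

/-- A product of functions with nonzero differentials at a common zero that agrees, up to units,
with a product of members of a system of local coordinates, has linearly independent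
differentials. -/
theorem linearIndependent_of_mul_prod_eventuallyEq {α β : Type*} [Fintype α] [Fintype β]
    {q : α → E → ℂ} {t : β → E → ℂ} {l : α → E →L[ℂ] ℂ} {τ : β → E →L[ℂ] ℂ} {u w : E → ℂ} {y : E}
    (hq : ∀ a, HasFDerivAt (q a) (l a) y) (hq0 : ∀ a, q a y = 0) (hl : ∀ a, l a ≠ 0)
    (ht : ∀ b, HasFDerivAt (t b) (τ b) y) (ht0 : ∀ b, t b y = 0) (hτ : LinearIndependent ℂ τ)
    (hw : ContinuousAt w y) (hw0 : w y ≠ 0) (hu : ContinuousAt u y) (hu0 : u y ≠ 0)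
    (h : ∀ᶠ z in 𝓝 y, w z * ∏ a, q a z = u z * ∏ b, t b z) : LinearIndependent ℂ l := by
  have hinj : Function.Injective (ContinuousLinearMap.coeLM ℂ : (E →L[ℂ] ℂ) →ₗ[ℂ] (E →ₗ[ℂ] ℂ)) :=
    ContinuousLinearMap.coe_injective
  have hτ' : LinearIndependent ℂ fun b => (τ b : Module.Dual ℂ E) :=
    hτ.map' (ContinuousLinearMap.coeLM ℂ) (LinearMap.ker_eq_bot.2 hinj)
  have hl' (a : α) : (l a : Module.Dual ℂ E) ≠ 0 := fun h0 =>
    hl a (ContinuousLinearMap.coe_injective h0)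
  have hline (v : E) : ∀ᶠ ε : ℂ in 𝓝[≠] 0,
      w (y + ε • v) * ∏ a, q a (y + ε • v) = u (y + ε • v) * ∏ b, t b (y + ε • v) := by
    have : Continuous fun ε : ℂ => y + ε • v := by fun_prop
    have := this.tendsto 0
    simp only [zero_smul, add_zero] at this
    exact (this.mono_left nhdsWithin_le_nhds).eventually h
  have lim1 (v : E) := tendsto_mul_prod_div_pow Finset.univ hw (fun a _ => hq a)
    (fun a _ => hq0 a) v
  have lim2 (v : E) := tendsto_mul_prod_div_pow Finset.univ hu (fun a _ => ht a)
    (fun a _ => ht0 a) v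
  have lim3 (v : E) : Tendsto (fun ε : ℂ => (w (y + ε • v) * ∏ a, q a (y + ε • v)) /
      ε ^ (Finset.univ : Finset β).card) (𝓝[≠] 0) (𝓝 (u y * ∏ b, τ b v)) := by
    refine (lim2 v).congr' ?_
    filter_upwards [hline v] with ε hε
    rw [hε]
  -- In a direction killed by none of the differentials, the two sides vanish to order exactly `card
  -- α` and `card β`.
  have hcard : Fintype.card α = Fintype.card β := by
    obtain ⟨v, hv⟩ := Module.Dual.exists_forall_ne_zero_of_forall_exists
      (Sum.elim (fun a => (l a : Module.Dual ℂ E)) fun b => (τ b : Module.Dual ℂ E)) (by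
        have aux (f : Module.Dual ℂ E) (hf : f ≠ 0) : ∃ v, f v ≠ 0 := by
          by_contra! h0
          exact hf (LinearMap.ext h0)
        rintro (a | b)
        · exact aux _ (hl' a)
        · exact aux _ (hτ'.ne_zero b))
    exact le_antisymm
      (le_of_tendsto_div_pow (mul_ne_zero hu0 (Finset.prod_ne_zero_iff.2 fun b _ =>
        hv (Sum.inr b))) (lim1 v) (lim3 v))
      (le_of_tendsto_div_pow (mul_ne_zero hw0 (Finset.prod_ne_zero_iff.2 fun b _ =>
        hv (Sum.inl b))) (lim3 v) (lim1 v))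
  have hli := linearIndependent_of_prod_eq hcard hτ' hl' hw0 (B := u y) fun v => by
    refine tendsto_nhds_unique (lim1 v) ?_
    have := lim3 v
    rw [Finset.card_univ, ← hcard] at this
    exact this
  exact LinearIndependent.of_comp (ContinuousLinearMap.coeLM ℂ) hli

end LeadingForm

/-! ### Common zeros of the polynomials `g'_i` -/

section CommonZeros

variable {n e : ℕ} {g : MvPolynomial (Fin (n + 1)) ℂ}

lemma eval_smul_of_isHomogeneous {σ : Type*} [Fintype σ] {g : MvPolynomial σ ℂ} {e : ℕ}
    (hg : g.IsHomogeneous e) (c : ℂ) (p : σ → ℂ) : eval (c • p) g = c ^ e * eval p g := by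
  rw [eval_eq', eval_eq', Finset.mul_sum]
  refine Finset.sum_congr rfl fun d hd => ?_
  have hde : ∑ i, d i = e := by
    rw [← Finsupp.degree_eq_sum, Finsupp.degree_eq_weight_one]
    exact hg (mem_support_iff.1 hd)
  simp only [Pi.smul_apply, smul_eq_mul, mul_pow, Finset.prod_mul_distrib,
    Finset.prod_pow_eq_pow_sum, hde]
  ring

lemma gPrime_isHomogeneous (hg : g.IsHomogeneous e) (he : 0 < e) (i : Fin (n + 1)) :
    (gPrime g i).IsHomogeneous e := by
  refine IsHomogeneous.add ?_ hg
  have := (isHomogeneous_X ℂ i).mul (hg.pderiv (i := i))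
  rwa [Nat.add_sub_cancel' he] at this

lemma sum_gPrime (hg : g.IsHomogeneous e) : ∑ i, gPrime g i = (e + (n + 1)) • g := by
  simp only [gPrime, Finset.sum_add_distrib, hg.sum_X_mul_pderiv, Finset.sum_const,
    Finset.card_univ, Fintype.card_fin, add_smul]

lemma hasFDerivAt_eval {σ : Type*} [Fintype σ] (g : MvPolynomial σ ℂ) (p : σ → ℂ) :
    HasFDerivAt (fun z : σ → ℂ => eval z g)
      (∑ i, eval p (pderiv i g) • (ContinuousLinearMap.proj i : (σ → ℂ) →L[ℂ] ℂ)) p := by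
  classical
  induction g using MvPolynomial.induction_on with
  | C a =>
    simp only [eval_C]
    refine (hasFDerivAt_const (𝕜 := ℂ) a p).congr_fderiv (ContinuousLinearMap.ext fun v => ?_)
    simp
  | add f g hf hg =>
    simp only [map_add]
    refine (hf.fun_add hg).congr_fderiv (ContinuousLinearMap.ext fun v => ?_)
    simp [add_mul, Finset.sum_add_distrib]
  | mul_X f j hf =>
    have hX : HasFDerivAt (fun z : σ → ℂ => z j)
        (ContinuousLinearMap.proj j : (σ → ℂ) →L[ℂ] ℂ) p := hasFDerivAt_apply j p
    simp only [eval_mul, eval_X]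
    refine (hf.fun_mul hX).congr_fderiv (ContinuousLinearMap.ext fun v => ?_)
    simp [pderiv_X, Pi.single_apply, add_mul, Finset.sum_add_distrib, Finset.mul_sum, apply_ite,
      mul_assoc]

lemma hasFDerivAt_affineChart (g : MvPolynomial (Fin (n + 1)) ℂ) (k : Fin (n + 1))
    (y : Fin n → ℂ) :
    HasFDerivAt (affineChart g k)
      (∑ j, eval (k.insertNth 1 y : Fin (n + 1) → ℂ) (pderiv (k.succAbove j) g) •
        (ContinuousLinearMap.proj j : (Fin n → ℂ) →L[ℂ] ℂ)) y := by
  have h1 : HasFDerivAt (fun z : Fin n → ℂ => (k.insertNth 1 z : Fin (n + 1) → ℂ))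
      (ContinuousLinearMap.pi (k.insertNth 0 fun j =>
        (ContinuousLinearMap.proj j : (Fin n → ℂ) →L[ℂ] ℂ))) y := by
    rw [hasFDerivAt_pi']
    intro i
    cases i using k.succAboveCases with
    | x => simpa using hasFDerivAt_const (1 : ℂ) y
    | p j => simpa using hasFDerivAt_apply j y
  have h2 := (hasFDerivAt_eval g (k.insertNth 1 y)).comp y h1
  convert! h2 using 1
  ext v
  simp [Fin.sum_univ_succAbove _ k]

lemma affineChart_prod_X_mul (g : MvPolynomial (Fin (n + 1)) ℂ) (k : Fin (n + 1))
    (z : Fin n → ℂ) : affineChart ((∏ i, X i) * g) k z = (∏ j, z j) * affineChart g k z := by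
  simp [affineChart, Fin.prod_univ_succAbove _ k]

/-- At a point where the coordinate hyperplanes and `g = 0` cross normally, the polynomials
`g'_i` do not vanish simultaneously. -/
lemma not_eval_gPrime_eq_zero_of_affine (hg : g.IsHomogeneous e) (hsmooth : IsSmoothHypersurface g)
    (hnc : IsNormalCrossingDivisor ((∏ i, X i) * g)) (k : Fin (n + 1)) (y : Fin n → ℂ)
    (h : ∀ i, eval (k.insertNth 1 y : Fin (n + 1) → ℂ) (gPrime g i) = 0) : False := by
  set p : Fin (n + 1) → ℂ := k.insertNth 1 y with hp
  have hpk : p k = 1 := by simp [hp]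
  have hpj (j : Fin n) : p (k.succAbove j) = y j := by simp [hp]
  have hgp : eval p g = 0 := by
    have h1 := congrArg (eval p) (sum_gPrime hg)
    rw [map_sum, Finset.sum_eq_zero fun i _ => h i, map_nsmul, nsmul_eq_mul] at h1
    refine (mul_eq_zero.1 h1.symm).resolve_left ?_
    exact Nat.cast_ne_zero.2 (by omega)
  have hpg (i : Fin (n + 1)) : p i * eval p (pderiv i g) = 0 := by
    simpa [gPrime, hgp] using h i
  have hp0 : p ≠ 0 := fun h0 => by simp [h0] at hpk
  obtain ⟨i, hi⟩ := hsmooth p hp0 hgp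
  -- Since `p k = 1`, the partial at `k` vanishes; the nonzero one therefore lies in a chart
  -- direction, so `L ≠ 0` below.
  have hik : i ≠ k := by
    rintro rfl
    have := hpg i
    rw [hpk, one_mul] at this
    exact hi this
  obtain ⟨j₀, rfl⟩ := Fin.exists_succAbove_eq hik
  have hchart : affineChart g k y = 0 := hgp
  obtain ⟨t, s, u, ⟨hta, ht0, hτ⟩, hua, hu0, hF⟩ :=
    hnc k y (by rw [affineChart_prod_X_mul, hchart, mul_zero])
  let c : Fin n → ℂ := fun j => eval p (pderiv (k.succAbove j) g)
  let L : (Fin n → ℂ) →L[ℂ] ℂ := ∑ j, c j • ContinuousLinearMap.proj j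
  have hc (j : Fin n) (hj : y j ≠ 0) : c j = 0 := by
    have := hpg (k.succAbove j)
    rw [hpj] at this
    exact (mul_eq_zero.1 this).resolve_left hj
  have hL : L ≠ 0 := fun h0 => hi (by
    have := congrArg (fun l : (Fin n → ℂ) →L[ℂ] ℂ => l (Pi.single j₀ 1)) h0
    simpa [L, c, Pi.single_apply] using this)
  -- The branches through `y` are `g` and the coordinates vanishing at `y`; the other coordinates
  -- form the unit `w`.
  let I := {j : Fin n // y j = 0}
  let q : Option I → (Fin n → ℂ) → ℂ := fun a => a.elim (affineChart g k) fun j z => z j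
  let l : Option I → (Fin n → ℂ) →L[ℂ] ℂ := fun a =>
    a.elim L fun j => ContinuousLinearMap.proj (j : Fin n)
  have hli : LinearIndependent ℂ l := by
    refine linearIndependent_of_mul_prod_eventuallyEq (β := s) (q := q) (t := fun b => t b)
      (τ := fun b => fderiv ℂ (t b) y) (u := u) (y := y)
      (w := fun z => ∏ j : {j : Fin n // ¬ y j = 0}, z j) ?_ ?_ ?_ ?_ ?_ ?_ ?_ ?_
      hua.continuousAt hu0 ?_
    · rintro (_ | j)
      · exact hasFDerivAt_affineChart g k y
      · exact hasFDerivAt_apply (j : Fin n) y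
    · rintro (_ | j)
      · exact hchart
      · exact j.2
    · rintro (_ | j)
      · exact hL
      · intro h0
        have := congrArg (fun l : (Fin n → ℂ) →L[ℂ] ℂ => l (Pi.single (j : Fin n) 1)) h0
        simp [l] at this
    · exact fun b => (hta b).differentiableAt.hasFDerivAt
    · exact fun b => ht0 b
    · exact hτ.comp _ Subtype.val_injective
    · exact Continuous.continuousAt (by fun_prop)
    · exact Finset.prod_ne_zero_iff.2 fun j _ => j.2
    · filter_upwards [hF] with z hz
      rw [affineChart_prod_X_mul] at hz
      rw [Finset.prod_coe_sort s fun b => t b z, ← hz, Fintype.prod_option,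
        ← Fintype.prod_subtype_mul_prod_subtype (fun j => y j = 0)]
      simp only [q, Option.elim]
      ring
  -- As `c j = 0` for `j` outside `I`, `L` is the combination of the coordinate forms in `I` with
  -- coefficients `c j`: a relation with coefficient `-1` on `L`.
  have hdep := Fintype.linearIndependent_iff.1 hli (fun a => a.elim (-1) fun j => c j) (by
    refine ContinuousLinearMap.ext fun v => ?_
    have hsum : ∑ j, c j * v j = ∑ j : I, c j * v j := by
      rw [← Fintype.sum_subtype_add_sum_subtype (fun j => y j = 0), add_eq_left]
      exact Fintype.sum_eq_zero _ fun j => by rw [hc j j.2, zero_mul]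
    simp [Fintype.sum_option, l, L, hsum]) none
  simp at hdep

theorem eq_zero_of_eval_gPrime_eq_zero (hg : g.IsHomogeneous e) (he : 0 < e)
    (hsmooth : IsSmoothHypersurface g) (hnc : IsNormalCrossingDivisor ((∏ i, X i) * g))
    (p : Fin (n + 1) → ℂ) (h : ∀ i, eval p (gPrime g i) = 0) : p = 0 := by
  by_contra hp
  obtain ⟨k, hk⟩ := Function.ne_iff.1 hp
  have hk : p k ≠ 0 := hk
  refine not_eval_gPrime_eq_zero_of_affine hg hsmooth hnc k
    (k.removeNth ((p k)⁻¹ • p)) fun i => ?_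
  have : (k.insertNth 1 (k.removeNth ((p k)⁻¹ • p)) : Fin (n + 1) → ℂ) = (p k)⁻¹ • p := by
    conv_rhs => rw [← Fin.insertNth_self_removeNth k ((p k)⁻¹ • p)]
    simp [hk]
  rw [this, eval_smul_of_isHomogeneous (gPrime_isHomogeneous hg he i), h, mul_zero]

end CommonZeros

/-! ### Graded Nakayama for generators of equal degree -/

section MinimalGenerators

variable {σ κ ι : Type*}

lemma homogeneousComponent_mul_of_isHomogeneous {d : ℕ} {q : MvPolynomial σ ℂ}
    (hq : q.IsHomogeneous d) (s : MvPolynomial σ ℂ) :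
    homogeneousComponent d (s * q) = constantCoeff s • q := by
  classical
  ext m
  rw [coeff_homogeneousComponent, coeff_smul, smul_eq_mul]
  split_ifs with hm
  · rw [coeff_mul, Finset.sum_eq_single (0, m)]
    · rfl
    · rintro ⟨a, b⟩ hab hne
      rw [Finset.HasAntidiagonal.mem_antidiagonal] at hab
      simp only at hab ⊢
      by_contra h0
      have hb : b.degree = d := by
        by_contra hb
        exact h0 (by rw [hq.coeff_eq_zero hb, mul_zero])
      have ha : a.degree = 0 := by
        have := congrArg Finsupp.degree hab
        rw [map_add, hm, hb] at this
        omega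
      have ha := (Finsupp.degree_eq_zero_iff a).1 ha
      subst ha
      rw [zero_add] at hab
      exact hne (by rw [hab])
    · simp
  · rw [hq.coeff_eq_zero hm, mul_zero]

/-- If finitely many homogeneous vectors of the same degree are linearly independent over the
ground field, the module they generate has no smaller generating set. -/
theorem card_le_card_of_span_eq [Fintype ι] {d : ℕ} {ρ : ι → κ → MvPolynomial σ ℂ}
    (hρ : ∀ i k, (ρ i k).IsHomogeneous d) (hli : LinearIndependent ℂ ρ)
    (T : Finset (κ → MvPolynomial σ ℂ))
    (hT : Submodule.span (MvPolynomial σ ℂ) (T : Set (κ → MvPolynomial σ ℂ)) =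
      Submodule.span (MvPolynomial σ ℂ) (Set.range ρ)) : Fintype.card ι ≤ T.card := by
  classical
  let φ : (κ → MvPolynomial σ ℂ) →ₗ[ℂ] (κ → MvPolynomial σ ℂ) :=
    LinearMap.pi fun k => homogeneousComponent d ∘ₗ LinearMap.proj k
  have hφρ (s : MvPolynomial σ ℂ) (i : ι) : φ (s • ρ i) = constantCoeff s • ρ i :=
    funext fun k => homogeneousComponent_mul_of_isHomogeneous (hρ i k) s
  -- On the span, taking degree-`d` parts turns polynomial scalars into their constant terms. So the
  -- images of `T` span over `ℂ` a space containing every `ρ i`.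
  have hφ : ∀ x ∈ Submodule.span (MvPolynomial σ ℂ) (Set.range ρ), ∀ s : MvPolynomial σ ℂ,
      φ (s • x) = constantCoeff s • φ x := by
    intro x hx
    induction hx using Submodule.span_induction with
    | mem x hx =>
      obtain ⟨i, rfl⟩ := hx
      intro s
      have := hφρ 1 i
      rw [one_smul, map_one, one_smul] at this
      rw [hφρ, this]
    | zero => simp
    | add x y _ _ hx hy => intro s; simp [hx, hy]
    | smul a x _ hx => intro s; rw [smul_smul, hx, hx, map_mul, smul_smul]
  have hmem : ∀ x ∈ Submodule.span (MvPolynomial σ ℂ) (T : Set (κ → MvPolynomial σ ℂ)),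
      φ x ∈ Submodule.span ℂ ((T.image φ : Finset _) : Set (κ → MvPolynomial σ ℂ)) := by
    intro x hx
    induction hx using Submodule.span_induction with
    | mem x hx => exact Submodule.subset_span (Finset.mem_coe.2 (Finset.mem_image_of_mem φ hx))
    | zero => simp
    | add x y _ _ hx hy => rw [map_add]; exact Submodule.add_mem _ hx hy
    | smul a x h hx => rw [hφ x (hT ▸ h)]; exact Submodule.smul_mem _ _ hx
  rw [← finrank_span_eq_card hli]
  refine (Submodule.finrank_mono ?_).trans
    ((finrank_span_finset_le_card (T.image φ)).trans Finset.card_image_le)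
  rw [Submodule.span_le]
  rintro _ ⟨i, rfl⟩
  have h1 := hmem (ρ i) (hT ▸ Submodule.subset_span ⟨i, rfl⟩)
  have h2 := hφρ 1 i
  rw [one_smul, map_one, one_smul] at h2
  rwa [h2] at h1

end MinimalGenerators

/-! ### From syzygies of `f` to Koszul syzygies of the `g'_i` -/

section Syzygies

variable {n e : ℕ} {g : MvPolynomial (Fin (n + 1)) ℂ}

lemma pderiv_prod_X_of_notMem {σ : Type*} {s : Finset σ} {j : σ} (hj : j ∉ s) :
    pderiv j (∏ i ∈ s, X i : MvPolynomial σ ℂ) = 0 := by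
  classical
  induction s using Finset.induction_on with
  | empty => simp
  | insert a s ha ih =>
    rw [Finset.mem_insert, not_or] at hj
    rw [Finset.prod_insert ha, pderiv_mul, ih hj.2, pderiv_X_of_ne (Ne.symm hj.1)]
    simp

lemma pderiv_prod_X_mul (g : MvPolynomial (Fin (n + 1)) ℂ) (j : Fin (n + 1)) :
    pderiv j ((∏ i, X i) * g) = (∏ i ∈ Finset.univ.erase j, X i) * gPrime g j := by
  rw [← Finset.mul_prod_erase _ _ (Finset.mem_univ j), pderiv_mul, pderiv_mul,
    pderiv_prod_X_of_notMem (Finset.notMem_erase _ _), pderiv_X_self, gPrime]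
  ring

lemma X_mul_mul_pderiv_prod_X_mul (g b : MvPolynomial (Fin (n + 1)) ℂ) (j : Fin (n + 1)) :
    X j * b * pderiv j ((∏ i, X i) * g) = (∏ i, X i) * (b * gPrime g j) := by
  rw [pderiv_prod_X_mul, ← Finset.mul_prod_erase _ _ (Finset.mem_univ j)]
  ring

lemma X_mul_mem_D₀_iff (b : Fin (n + 1) → MvPolynomial (Fin (n + 1)) ℂ) :
    (fun j => X j * b j) ∈ D₀ ((∏ i, X i) * g) ↔ ∑ j, b j * gPrime g j = 0 := by
  change ∑ j, X j * b j * pderiv j ((∏ i, X i) * g) = 0 ↔ _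
  simp only [X_mul_mul_pderiv_prod_X_mul, ← Finset.mul_sum]
  rw [mul_eq_zero, or_iff_right]
  exact Finset.prod_ne_zero_iff.2 fun i _ => X_ne_zero i

/-- If `x_j` divided `g`, then at a coordinate point `e_k` with `k ≠ j` both `g` and, by Euler,
`g_k` would vanish, making `e_k` a common zero of the `g'_i`. -/
lemma not_X_dvd (hn : 1 ≤ n) (hg : g.IsHomogeneous e)
    (hz : ∀ p, (∀ i, eval p (gPrime g i) = 0) → p = 0) (j : Fin (n + 1)) : ¬ X j ∣ g := by
  rintro ⟨q, rfl⟩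
  have : Nontrivial (Fin (n + 1)) := Fin.nontrivial_iff_two_le.2 (by omega)
  obtain ⟨k, hk⟩ := exists_ne j
  have hg0 : eval (Pi.single k 1) (X j * q) = 0 := by simp [hk.symm]
  have h1 := congrArg (eval (Pi.single k 1)) hg.sum_X_mul_pderiv
  rw [map_sum, map_nsmul, hg0, smul_zero] at h1
  simp only [map_mul, eval_X] at h1
  have h2 : (Pi.single k 1 : Fin (n + 1) → ℂ) = 0 := by
    refine hz _ fun i => ?_
    rw [gPrime, map_add, hg0, add_zero, map_mul, eval_X]
    by_cases hik : i = k
    · subst hik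
      rw [Finset.sum_eq_single i (fun b _ hb => by simp [hb]) (by simp)] at h1
      exact h1
    · simp [hik]
  simpa using congrFun h2 k

lemma exists_eq_X_mul_of_mem_D₀ (hX : ∀ j, ¬ X j ∣ g)
    {a : Fin (n + 1) → MvPolynomial (Fin (n + 1)) ℂ} (ha : a ∈ D₀ ((∏ i, X i) * g)) :
    ∃ b : Fin (n + 1) → MvPolynomial (Fin (n + 1)) ℂ, a = fun j => X j * b j := by
  suffices h : ∀ j, X j ∣ a j by
    choose b hb using h
    exact ⟨b, funext hb⟩
  intro j
  have ha : ∑ i, a i * pderiv i ((∏ i, X i) * g) = 0 := ha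
  rw [← Finset.add_sum_erase _ _ (Finset.mem_univ j)] at ha
  have hp : Prime (X j : MvPolynomial (Fin (n + 1)) ℂ) := X_prime
  have h1 : X j ∣ a j * pderiv j ((∏ i, X i) * g) := by
    rw [eq_neg_of_add_eq_zero_left ha]
    refine (Finset.dvd_sum fun i hi => Dvd.dvd.mul_left ?_ _).neg_right
    rw [pderiv_prod_X_mul]
    exact Dvd.dvd.mul_right (Finset.dvd_prod_of_mem _
      (Finset.mem_erase.2 ⟨(Finset.ne_of_mem_erase hi).symm, Finset.mem_univ j⟩)) _
  rw [pderiv_prod_X_mul] at h1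
  refine (hp.dvd_or_dvd h1).resolve_right fun h2 => ?_
  rcases hp.dvd_or_dvd h2 with h3 | h3
  · obtain ⟨i, hi, hji⟩ := (hp.dvd_finsetProd_iff _).1 h3
    rw [X_dvd_X] at hji
    exact Finset.ne_of_mem_erase hi hji.symm
  -- `g'_j` and `g` differ by a multiple of `X j`.
  · exact hX j ((dvd_add_right (Dvd.intro _ rfl)).1 h3)

lemma rhoPrime_apply_of_ne {i j : Fin (n + 1)} (hij : i ≠ j) (k : Fin (n + 1)) :
    rhoPrime g i j k =
      (if k = i then X k * gPrime g j else 0) - if k = j then X k * gPrime g i else 0 := by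
  unfold rhoPrime
  by_cases hi : k = i
  · subst hi
    simp [hij]
  · by_cases hj : k = j
    · subst hj
      simp [hi]
    · simp [hi, hj]

/-- The index set of the generators `ρ'_{ij}`. -/
abbrev IncreasingPair (n : ℕ) := {p : Fin (n + 1) × Fin (n + 1) // p.1 < p.2}

/-- The bridge between Koszul relations of the `g'_j` and combinations of the `ρ'_{ij}`, used for
both generation and independence: skew-symmetry recovers the entries below the diagonal from the
pairs `i < j`. -/
lemma sum_smul_rhoPrime (A : Fin (n + 1) → Fin (n + 1) → MvPolynomial (Fin (n + 1)) ℂ)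
    (h0 : ∀ i, A i i = 0) (hA : ∀ i j, A i j = -A j i) :
    ∑ p : IncreasingPair n, A p.1.1 p.1.2 • rhoPrime g p.1.1 p.1.2 =
      fun k => X k * ∑ j, A k j * gPrime g j := by
  funext k
  rw [Finset.sum_apply]
  have h1 : ∀ p : IncreasingPair n, (A p.1.1 p.1.2 • rhoPrime g p.1.1 p.1.2) k =
      (fun p : Fin (n + 1) × Fin (n + 1) =>
        (if k = p.1 then A p.1 p.2 * (X k * gPrime g p.2) else 0) -
          if k = p.2 then A p.1 p.2 * (X k * gPrime g p.1) else 0) p.1 := fun p => by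
    rw [Pi.smul_apply, rhoPrime_apply_of_ne p.2.ne, smul_eq_mul, mul_sub, mul_ite, mul_ite,
      mul_zero]
  have h2 (x y : Fin (n + 1)) : (if x < y then
      (if k = x then A x y * (X k * gPrime g y) else 0) -
        (if k = y then A x y * (X k * gPrime g x) else 0) else 0) =
      (if k = x then if k < y then A k y * (X k * gPrime g y) else 0 else 0) +
        if k = y then if x < k then A k x * (X k * gPrime g x) else 0 else 0 := by
    by_cases hx : k = x <;> by_cases hy : k = y
    · subst hx; subst hy; simp
    · subst hx; simp [hy]
    · subst hy
      simp only [hx, if_false, if_true, zero_sub, zero_add]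
      rw [hA x k, neg_mul, neg_neg]
    · simp [hx, hy]
  rw [Finset.sum_congr rfl fun p _ => h1 p,
    ← Finset.sum_subtype (Finset.univ.filter fun p : Fin (n + 1) × Fin (n + 1) => p.1 < p.2)
      (by simp) fun p => (if k = p.1 then A p.1 p.2 * (X k * gPrime g p.2) else 0) -
        if k = p.2 then A p.1 p.2 * (X k * gPrime g p.1) else 0,
    Finset.sum_filter, ← Finset.univ_product_univ, Finset.sum_product]
  simp only [h2, Finset.sum_add_distrib]
  rw [Finset.sum_comm]
  simp only [Finset.sum_ite_eq, Finset.mem_univ, if_true, ← Finset.sum_add_distrib,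
    Finset.mul_sum]
  refine Finset.sum_congr rfl fun j _ => ?_
  rcases lt_trichotomy k j with h | h | h
  · simp [h, h.not_gt, mul_left_comm]
  · simp [h, h0]
  · simp [h, h.not_gt, mul_left_comm]

lemma card_increasingPair : Fintype.card (IncreasingPair n) = (n + 1).choose 2 := by
  rw [Fintype.card_subtype, Finset.card_filter, ← Finset.univ_product_univ,
    Finset.sum_product_right]
  have (j : Fin (n + 1)) : (∑ i : Fin (n + 1), if i < j then 1 else 0) = (j : ℕ) := by
    rw [← Finset.card_filter, ← Fin.card_Iio]
    congr 1
    ext i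
    simp
  simp only [this]
  rw [Fin.sum_univ_eq_sum_range (fun i => i), Finset.sum_range_id, Nat.choose_two_right]

/-- Coefficients of a Koszul relation lie in the ideal of the `h i`, whose constant terms are zero;
constant coefficients must therefore vanish. -/
lemma linearIndependent_of_hasKoszulSyzygies {m r e : ℕ} {h : Fin r → MvPolynomial (Fin m) ℂ}
    (hK : HasKoszulSyzygies (MvPolynomial (Fin m) ℂ) h) (hh : ∀ i, (h i).IsHomogeneous e)
    (he : 0 < e) : LinearIndependent ℂ h := by
  rw [Fintype.linearIndependent_iff]
  intro c hc i
  obtain ⟨A, -, -, hA⟩ := hK (fun i => C (c i)) (by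
    rw [← hc]
    exact Finset.sum_congr rfl fun j _ => by rw [smul_eq_mul, smul_eq_C_mul, mul_comm])
  have h0 (j : Fin r) : constantCoeff (h j) = 0 := by
    rw [constantCoeff_eq]
    exact (hh j).coeff_eq_zero (by simpa using he.ne)
  have := congrArg constantCoeff (hA i)
  simpa [h0] using this

/-- After cancelling `x_k`, the `k`-th component of a constant relation is a constant relation among
the `g'_j`. -/
lemma linearIndependent_rhoPrime
    (hK : HasKoszulSyzygies (MvPolynomial (Fin (n + 1)) ℂ) (gPrime g))
    (hg : g.IsHomogeneous e) (he : 0 < e) :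
    LinearIndependent ℂ fun p : IncreasingPair n => rhoPrime g p.1.1 p.1.2 := by
  have hli := linearIndependent_of_hasKoszulSyzygies hK (gPrime_isHomogeneous hg he) he
  rw [Fintype.linearIndependent_iff] at hli ⊢
  intro c hc p
  let a : Fin (n + 1) → Fin (n + 1) → ℂ := fun i j =>
    if h : i < j then c ⟨(i, j), h⟩ else if h : j < i then -c ⟨(j, i), h⟩ else 0
  have ha (p : IncreasingPair n) : a p.1.1 p.1.2 = c p := dif_pos p.2
  have hsum := sum_smul_rhoPrime (g := g) (fun i j => C (a i j)) (by simp [a]) (fun i j => by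
    rw [← map_neg]
    congr 1
    rcases lt_trichotomy i j with h | rfl | h
    · simp [a, h, h.not_gt]
    · simp [a]
    · simp [a, h, h.not_gt])
  have hzero : ∑ p : IncreasingPair n,
      (C (a p.1.1 p.1.2) : MvPolynomial (Fin (n + 1)) ℂ) • rhoPrime g p.1.1 p.1.2 = 0 := by
    rw [← hc]
    refine Finset.sum_congr rfl fun p _ => funext fun k => ?_
    rw [ha, Pi.smul_apply, Pi.smul_apply, smul_eq_C_mul, smul_eq_mul]
  rw [hsum] at hzero
  rw [← ha p]
  refine hli (a p.1.1) ?_ p.1.2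
  have := (mul_eq_zero.1 (congrFun hzero p.1.1)).resolve_left (X_ne_zero _)
  simpa only [smul_eq_C_mul] using this

lemma span_rhoPrime_eq_D₀
    (hK : HasKoszulSyzygies (MvPolynomial (Fin (n + 1)) ℂ) (gPrime g)) (hX : ∀ j, ¬ X j ∣ g) :
    Submodule.span (MvPolynomial (Fin (n + 1)) ℂ)
      (Set.range fun p : IncreasingPair n => rhoPrime g p.1.1 p.1.2) = D₀ ((∏ i, X i) * g) := by
  apply le_antisymm
  · rw [Submodule.span_le]
    rintro _ ⟨⟨⟨i, j⟩, hij⟩, rfl⟩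
    have hij : i ≠ j := ne_of_lt hij
    have : rhoPrime g i j = fun k => X k *
        ((if k = i then gPrime g j else 0) - if k = j then gPrime g i else 0) := funext fun k => by
      rw [rhoPrime_apply_of_ne hij, mul_sub, mul_ite, mul_ite, mul_zero]
    simp only [SetLike.mem_coe, this]
    rw [X_mul_mem_D₀_iff]
    simp [sub_mul, Finset.sum_sub_distrib, mul_comm (gPrime g j)]
  · intro a ha
    obtain ⟨b, rfl⟩ := exists_eq_X_mul_of_mem_D₀ hX ha
    rw [X_mul_mem_D₀_iff] at ha
    obtain ⟨A, h0, hA, hb⟩ := hK b (by simpa only [smul_eq_mul, mul_comm] using ha)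
    have : (fun j => X j * b j) = fun k => X k * ∑ j, A k j * gPrime g j := funext fun k => by
      rw [hb]
      simp only [smul_eq_mul, mul_comm]
    rw [this, ← sum_smul_rhoPrime A h0 hA]
    exact Submodule.sum_mem _ fun p _ => Submodule.smul_mem _ _ (Submodule.subset_span ⟨p, rfl⟩)

lemma rhoPrime_isHomogeneous (hg : g.IsHomogeneous e) (he : 0 < e) (i j k : Fin (n + 1)) :
    (rhoPrime g i j k).IsHomogeneous (e + 1) := by
  have h (i j : Fin (n + 1)) : (X i * gPrime g j).IsHomogeneous (e + 1) := by
    have := (isHomogeneous_X ℂ i).mul (gPrime_isHomogeneous hg he j)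
    rwa [add_comm 1 e] at this
  unfold rhoPrime
  split_ifs
  · exact h i j
  · exact (h j i).neg
  · exact isHomogeneous_zero _ _ _

lemma rhoPrime_ne_zero_iff (h0 : ∀ i, gPrime g i ≠ 0) (i j k : Fin (n + 1)) :
    rhoPrime g i j k ≠ 0 ↔ k = i ∨ k = j := by
  unfold rhoPrime
  split_ifs with hi hj
  · simp [hi, h0, X_ne_zero]
  · simp [hj, h0, X_ne_zero]
  · simp [hi, hj]

end Syzygies

end JacobianSyzygies

end

/-! ### The main theorem -/

theorem corollary1p2 (n e : ℕ) (hn : 2 ≤ n) (he : 0 < e)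
    (g f : MvPolynomial (Fin (n + 1)) ℂ) (hg : g.IsHomogeneous e)
    (hsmooth : JacobianSyzygies.IsSmoothHypersurface g)
    (hf : f = (∏ i, MvPolynomial.X i) * g)
    (hnc : JacobianSyzygies.IsNormalCrossingDivisor f) :
    (∀ i j : Fin (n + 1), i < j →
      (∀ k, (JacobianSyzygies.rhoPrime g i j k).IsHomogeneous (e + 1)) ∧
      (∀ k, JacobianSyzygies.rhoPrime g i j k ≠ 0 ↔ k = i ∨ k = j)) ∧
    JacobianSyzygies.IsMinimalGenerators
      {ρ | ∃ i j : Fin (n + 1), i < j ∧ ρ = JacobianSyzygies.rhoPrime g i j}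
      (JacobianSyzygies.D₀ f) ∧
    {ρ | ∃ i j : Fin (n + 1), i < j ∧ ρ = JacobianSyzygies.rhoPrime g i j}.ncard =
      (n + 1).choose 2 ∧
    (JacobianSyzygies.D₀ f).spanFinrank = (n + 1).choose 2 := by
  open JacobianSyzygies in
  subst hf
  have hz := eq_zero_of_eval_gPrime_eq_zero hg he hsmooth hnc
  have hK := hasKoszulSyzygies_of_eval_eq_zero (gPrime g) hz
  have hspan := span_rhoPrime_eq_D₀ hK (not_X_dvd (by omega) hg hz)
  have hli := linearIndependent_rhoPrime hK hg he
  have hne := (linearIndependent_of_hasKoszulSyzygies hK (gPrime_isHomogeneous hg he) he).ne_zero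
  have hset : {ρ | ∃ i j : Fin (n + 1), i < j ∧ ρ = rhoPrime g i j} =
      Set.range fun p : IncreasingPair n => rhoPrime g p.1.1 p.1.2 := by
    ext ρ
    constructor
    · rintro ⟨i, j, hij, rfl⟩
      exact ⟨⟨(i, j), hij⟩, rfl⟩
    · rintro ⟨p, rfl⟩
      exact ⟨p.1.1, p.1.2, p.2, rfl⟩
  rw [hset]
  have hcard : (Set.range fun p : IncreasingPair n => rhoPrime g p.1.1 p.1.2).ncard =
      (n + 1).choose 2 := by
    rw [← Set.image_univ, Set.ncard_image_of_injective _ hli.injective, Set.ncard_univ,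
      Nat.card_eq_fintype_card, card_increasingPair]
  -- This one bound excludes both proper generating subsets and smaller generating sets.
  have hmin (T : Finset (Fin (n + 1) → MvPolynomial (Fin (n + 1)) ℂ))
      (hT : Submodule.span (MvPolynomial (Fin (n + 1)) ℂ) (T : Set _) =
        D₀ ((∏ i, MvPolynomial.X i) * g)) : (n + 1).choose 2 ≤ T.card := by
    rw [← card_increasingPair]
    exact card_le_card_of_span_eq (ρ := fun p : IncreasingPair n => rhoPrime g p.1.1 p.1.2)
      (fun p k => rhoPrime_isHomogeneous hg he p.1.1 p.1.2 k) hli T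
      (hT.trans hspan.symm)
  have hfin := Set.finite_range fun p : IncreasingPair n => rhoPrime g p.1.1 p.1.2
  refine ⟨fun i j _ => ⟨rhoPrime_isHomogeneous hg he i j, rhoPrime_ne_zero_iff hne i j⟩,
    ⟨hspan, fun Y hY hYX => ?_⟩, hcard, le_antisymm ?_ ?_⟩
  · have hYfin := hfin.subset hYX
    have h1 := hmin hYfin.toFinset (by simpa using hY)
    rw [← hcard, ← Set.ncard_eq_toFinset_card Y hYfin] at h1
    exact (Set.eq_of_subset_of_ncard_le hYX h1 hfin).ge
  · rw [← hcard, ← hspan]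
    exact Submodule.spanFinrank_span_le_ncard_of_finite hfin
  · obtain ⟨T, hTcard, hT⟩ := Submodule.FG.exists_span_finset_card_eq_spanFinrank
      (p := D₀ ((∏ i, MvPolynomial.X i) * g)) (IsNoetherian.noetherian _)
    rw [← hTcard]
    exact hmin T hT
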